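/- Let $F$ be a field of characteristic zero and let $A$ be either $F[x,y]$ or $F_0[x,y]=(x,y)\subset F[x,y]$ (a non-unital algebra). Put $e=0$ if $A=F[x,y]$ and $e=1$ if $A=F_0[x,y]$; thus $x^ny^m$ is a monomial of $A$ iff $n+m\ge e$. Put $\nu(0)=e$ and $\nu(n)=0$ for $n>0$. Let $p_x>0$, $p_y\ge 0$ be integers, let $T$ be an averaging operator on $A$ (linear, with $T(a)T(b)=T(T(a)b)=T(aT(b))$) of the form $T(x^ny^m)=\alpha_{n,m}x^{n+p_x}y^{m+p_y}$, and let $R$ be the linear operator with $R(x^ny^m)=\gamma_{n,m}T(x^ny^m)$, where $\gamma_{n,m}\in F$ and, by convention, $\gamma_{n,m}=0$ whenever $\alpha_{n,m}=0$. Then $R$ is a Rota–Baxter operator of weight zero, i.e. $R(a)R(b)=R(R(a)b+aR(b))$, if and only if $\gamma_{n,m}=0$ for all monomials $x^ny^m$ of $A$ or one of the following holds. (a) There are integers $k,c,a,b\ge 0$ and $r>0$ with $ra=k+p_x$, $rb=c+p_y$, $k+c\ge e$, such that $(k-a,c-b)$ is not the exponent of a monomial of $A$, and, for all $n+m\ge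 e$, $$\gamma_{n,m}=\begin{cases}\dfrac{r\,\gamma_{k,c}}{r+s}, & n=k+as,\ m=c+bs,\ s\ge 0,\\ 0,&\text{otherwise,}\end{cases}\qquad \gamma_{k,c}\neq 0.$$ (b) $p_y=0$, and there are integers $c,\Delta>0$, $r$, and sequences $(k_n)_{n\ge 0}$, $(\sigma_n)_{n\ge 0}$ of non-negative integers with $0\le k_n-\nu(n)<\Delta$ for all $n\ge 0$, $\Delta\sigma_0=\Delta r=k_0+p_x$ and $k_n=nk_1+(n-1)p_x-\Delta\sum_{s=1}^{n-1}\sigma_s$ for $n\ge 1$, such that $\gamma_{k_0,0},\gamma_{k_1,c}\ne 0$ and, for all $s+t\ge e$, $$\gamma_{s,t}=\begin{cases}\dfrac{r\gamma_{k_0,0}\gamma_{k_1,c}}{rv\gamma_{k_0,0}+\bigl(u+r-\sum_{i=0}^{v-1}\sigma_i\bigr)\gamma_{k_1,c}}, & s=k_v+\Delta u,\ t=cv,\ u,v\ge 0,\\ 0,&\text{otherwise,}\end{cases}$$ where all the denominators are nonzero. (b') $p_y>0$, and there are integers $\Delta_x,\Delta_y,r_y>0$ and $0\le c_y<\Delta_y$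 with $r_y\Delta_y=c_y+p_y$, and sequences $(k_l)_{l\ge0}$, $(\sigma_{0,l})_{l\ge 0}$, $(\sigma_{1,l})_{1\le l<r_y}$ of non-negative integers with $0\le k_l-\nu(c_y+\Delta_y l)<\Delta_x$ for all $l$ and, for all $i\ge 0$ and $0\le j<r_y$, $$r_yk_{ir_y+j}=((i+1)r_y+j)k_0+(ir_y+j)p_x-\Delta_x\Bigl(\tau_j+r_y\sum_{s=0}^{i-1}\sigma_{0,sr_y+j}\Bigr),$$ $$\tau_j=j\sigma_{0,0}+j\sum_{s=1}^{r_y-1}(\sigma_{0,s+1}-\sigma_{1,s})-r_y\sum_{s=1}^{j-1}(\sigma_{0,s+1}-\sigma_{1,s}),$$ such that $\gamma_{k_0,c_y},\gamma_{k_0+\Delta_x,c_y}\neq0$ and, for all $s+t\ge e$, $$\gamma_{s,t}=\begin{cases}\dfrac{r_y}{\frac{r_yu-H(v)}{\gamma_{k_0+\Delta_x,c_y}}+\frac{H(v)+v-r_y(u-1)}{\gamma_{k_0,c_y}}}, & s=k_v+\Delta_xu,\ t=c_y+\Delta_yv,\ u,v\ge0,\\ 0,&\text{otherwise,}\end{cases}$$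 where all the denominators (the sums of the two fractions) are nonzero and, for $a\ge0$, $0\le b<r_y$, $$H(ar_y+b)=r_y\sum_{s=0}^{a-1}\sigma_{0,sr_y+b}-r_y\sum_{s=1}^{b-1}(\sigma_{0,s+1}-\sigma_{1,s})+b\sigma_{0,0}+b\sum_{s=1}^{r_y-1}(\sigma_{0,s+1}-\sigma_{1,s}).$$ (A sum whose upper limit is less than its lower limit is $0$.) Moreover, if the set of exponents of monomials of $A$ outside $\ker T$ is a ray $\{(k+as,c+bs)\mid s\ge0\}$ with parameters as in (a), then $R$ is a Rota–Baxter operator of weight zero iff all $\gamma_{n,m}=0$ or (a) holds for some parameters. Finally, if the set $\{(n,m)\mid n+m\ge e,\ \gamma_{n,m}\neq0\}$ is the set of exponents in the first line of the formula of (a), (b) or (b') for some given parameters as there (with $p_y=0$ in (b), $p_y>0$ in (b')) — in particular, if it equals $\{(n,m)\mid n+m\ge e,\ \alpha_{n,m}\ne0\}$ and $T$ is described by these parameters — then $R$ is a Rota–Baxter operator of weight zero iff the corresponding formula, with its nonvanishing conditions, holds with these same parameters. -/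

import Mathlib

/-- `R` is a Rota-Baxter operator of weight `w` on the (possibly non-unital) algebra `A`. -/
def IsRotaBaxter {F A : Type*} [Field F] [NonUnitalNonAssocRing A] [Module F A]
    (w : F) (R : A →ₗ[F] A) : Prop :=
  ∀ a b : A, R a * R b = R (R a * b + a * R b + w • (a * b))

/-- `T` is an averaging operator on the (possibly non-unital) algebra `A`. -/
def IsAveraging {F A : Type*} [Field F] [NonUnitalNonAssocRing A] [Module F A]
    (T : A →ₗ[F] A) : Prop :=
  ∀ a b : A, T a * T b = T (T a * b) ∧ T (T a * b) = T (a * T b)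

/-- The monomial `x ^ n * y ^ m` of `F[x, y]`. -/
noncomputable def xyMonomial (F : Type*) [Field F] (n m : ℕ) : MvPolynomial (Fin 2) F :=
  MvPolynomial.X 0 ^ n * MvPolynomial.X 1 ^ m

/-- `F₀[x, y]`: the ideal `(x, y)` of `F[x, y]`, as a non-unital algebra. -/
noncomputable def PolyZero (F : Type*) [Field F] :
    NonUnitalSubalgebra F (MvPolynomial (Fin 2) F) where
  carrier := (Ideal.span {MvPolynomial.X 0, MvPolynomial.X 1} : Ideal (MvPolynomial (Fin 2) F))
  add_mem' := fun ha hb => Ideal.add_mem _ ha hb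
  zero_mem' := Ideal.zero_mem _
  mul_mem' := fun _ hb => Ideal.mul_mem_left _ _ hb
  smul_mem' := fun c x hx => by
    rw [MvPolynomial.smul_eq_C_mul]
    exact Ideal.mul_mem_left _ _ hx

theorem xyMonomial_mem_polyZero (F : Type*) [Field F] (n m : ℕ) (h : 1 ≤ n + m) :
    xyMonomial F n m ∈ PolyZero F := by
  change xyMonomial F n m ∈
    (Ideal.span {MvPolynomial.X 0, MvPolynomial.X 1} : Ideal (MvPolynomial (Fin 2) F))
  unfold xyMonomial
  rcases Nat.eq_zero_or_pos n with hn | hn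
  · apply Ideal.mul_mem_left
    exact Ideal.pow_mem_of_mem _ (Ideal.subset_span (by simp)) _ (by omega)
  · apply Ideal.mul_mem_right
    exact Ideal.pow_mem_of_mem _ (Ideal.subset_span (by simp)) _ hn

/-- The monomial `x ^ n * y ^ m`, `n + m ≥ 1`, as an element of `F₀[x, y]`. -/
noncomputable def xyMonomialZero (F : Type*) [Field F] (n m : ℕ) (h : 1 ≤ n + m) : PolyZero F :=
  ⟨xyMonomial F n m, xyMonomial_mem_polyZero F n m h⟩

/-!
Below, `e` is `0` for the algebra `F[x, y]` and `1` for `F₀[x, y]`, so that `x ^ n * y ^ m` is a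
monomial of the algebra if and only if `e ≤ n + m`.
-/

/-- The function `ν`, with `ν(0) = e` and `ν(n) = 0` for `n > 0`. -/
def nuFun (e n : ℕ) : ℕ := if n = 0 then e else 0

/-- Case (a). The parameters of a ray `(k, c) + s (a, b)`, `s ≥ 0`, of exponents, where
`a = (k + p_x) / r` and `b = (c + p_y) / r`, and where `(k, c)` is its first point in the
algebra. -/
structure RayParams (e px py : ℕ) where
  (k c r a b : ℕ)
  r_pos : 0 < r
  r_mul_a : r * a = k + px
  r_mul_b : r * b = c + py
  start_mem : e ≤ k + c
  start_first : ¬ (a ≤ k ∧ b ≤ c ∧ e ≤ (k - a) + (c - b))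

/-- The exponents on the ray. -/
def RayParams.Mem {e px py : ℕ} (D : RayParams e px py) (n m : ℕ) : Prop :=
  ∃ s : ℕ, n = D.k + D.a * s ∧ m = D.c + D.b * s

/-- The coefficients of a Rota-Baxter operator supported on the ray. -/
def RayParams.Formula {F : Type*} [Field F] {e px py : ℕ} (D : RayParams e px py)
    (γ : ℕ → ℕ → F) : Prop :=
  γ D.k D.c ≠ 0 ∧
  (∀ s : ℕ, γ (D.k + D.a * s) (D.c + D.b * s) = (D.r : F) * γ D.k D.c / ((D.r : F) + (s : F))) ∧
  (∀ n m : ℕ, e ≤ n + m → ¬ D.Mem n m → γ n m = 0)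

/-- Case (b) with `p_y = 0`. The parameters of a set of exponents `(k_v + Δ u, c v)`,
`u, v ≥ 0`. -/
structure FlatParams (e px : ℕ) where
  (c Δ r : ℕ)
  (k σ : ℕ → ℕ)
  c_pos : 0 < c
  Δ_pos : 0 < Δ
  le_k : ∀ n, nuFun e n ≤ k n
  k_lt : ∀ n, k n - nuFun e n < Δ
  Δ_mul_r : Δ * r = k 0 + px
  σ_zero : σ 0 = r
  k_eq : ∀ n, 1 ≤ n →
    (k n : ℤ) = n * k 1 + (n - 1) * px - Δ * ∑ s ∈ Finset.Icc 1 (n - 1), (σ s : ℤ)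

/-- The exponents of the given set. -/
def FlatParams.Mem {e px : ℕ} (D : FlatParams e px) (n m : ℕ) : Prop :=
  ∃ u v : ℕ, n = D.k v + D.Δ * u ∧ m = D.c * v

/-- The denominator in the formula for the coefficients, `p_y = 0`. -/
noncomputable def FlatParams.denom {F : Type*} [Field F] {e px : ℕ} (D : FlatParams e px)
    (γ : ℕ → ℕ → F) (u v : ℕ) : F :=
  (D.r : F) * (v : F) * γ (D.k 0) 0 +
    ((u : F) + (D.r : F) - ∑ s ∈ Finset.range v, (D.σ s : F)) * γ (D.k 1) D.c

/-- The coefficients of a Rota-Baxter operator supported on the given set, `p_y = 0`. -/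
def FlatParams.Formula {F : Type*} [Field F] {e px : ℕ} (D : FlatParams e px)
    (γ : ℕ → ℕ → F) : Prop :=
  γ (D.k 0) 0 ≠ 0 ∧ γ (D.k 1) D.c ≠ 0 ∧
  (∀ u v : ℕ, D.denom γ u v ≠ 0 ∧
    γ (D.k v + D.Δ * u) (D.c * v) = (D.r : F) * γ (D.k 0) 0 * γ (D.k 1) D.c / D.denom γ u v) ∧
  (∀ n m : ℕ, e ≤ n + m → ¬ D.Mem n m → γ n m = 0)

/-- The number `τ_j`. -/
def tauSeq (r : ℕ) (σ₀ σ₁ : ℕ → ℕ) (j : ℕ) : ℤ :=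
  j * σ₀ 0 + ∑ s ∈ Finset.Ico 1 r, (j : ℤ) * ((σ₀ (s + 1) : ℤ) - σ₁ s)
    - ∑ s ∈ Finset.Ico 1 j, (r : ℤ) * ((σ₀ (s + 1) : ℤ) - σ₁ s)

/-- The number `H(a r + b)`, where `0 ≤ b < r`. -/
def hSeqAux (r : ℕ) (σ₀ σ₁ : ℕ → ℕ) (a b : ℕ) : ℤ :=
  r * ∑ s ∈ Finset.range a, (σ₀ (s * r + b) : ℤ)
    - r * ∑ s ∈ Finset.Ico 1 b, ((σ₀ (s + 1) : ℤ) - σ₁ s)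
    + b * σ₀ 0 + b * ∑ s ∈ Finset.Ico 1 r, ((σ₀ (s + 1) : ℤ) - σ₁ s)

/-- The function `H`. -/
def hSeq (r : ℕ) (σ₀ σ₁ : ℕ → ℕ) (v : ℕ) : ℤ := hSeqAux r σ₀ σ₁ (v / r) (v % r)

/-- Case (b) with `p_y > 0`. The parameters of a set of exponents
`(k_v + Δ_x u, c_y + Δ_y v)`, `u, v ≥ 0`. -/
structure LatticeParams (e px py : ℕ) where
  (cy ry Δx Δy : ℕ)
  (k σ₀ σ₁ : ℕ → ℕ)
  ry_pos : 0 < ry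
  Δx_pos : 0 < Δx
  cy_lt : cy < Δy
  ry_mul : ry * Δy = cy + py
  le_k : ∀ l, nuFun e (cy + Δy * l) ≤ k l
  k_lt : ∀ l, k l - nuFun e (cy + Δy * l) < Δx
  k_eq : ∀ i j, j < ry →
    (ry : ℤ) * k (i * ry + j) = ((i + 1) * ry + j) * k 0 + (i * ry + j) * px
      - Δx * (tauSeq ry σ₀ σ₁ j + ∑ s ∈ Finset.range i, (ry : ℤ) * σ₀ (s * ry + j))

/-- The exponents of the given set. -/
def LatticeParams.Mem {e px py : ℕ} (D : LatticeParams e px py) (n m : ℕ) : Prop :=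
  ∃ u v : ℕ, n = D.k v + D.Δx * u ∧ m = D.cy + D.Δy * v

/-- The denominator in the formula for the coefficients, `p_y > 0`. -/
noncomputable def LatticeParams.denom {F : Type*} [Field F] {e px py : ℕ}
    (D : LatticeParams e px py) (γ : ℕ → ℕ → F) (u v : ℕ) : F :=
  ((D.ry : F) * (u : F) - (hSeq D.ry D.σ₀ D.σ₁ v : F)) / γ (D.k 0 + D.Δx) D.cy +
    ((hSeq D.ry D.σ₀ D.σ₁ v : F) + (v : F) - (D.ry : F) * ((u : F) - 1)) / γ (D.k 0) D.cy

/-- The coefficients of a Rota-Baxter operator supported on the given set, `p_y > 0`. -/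
def LatticeParams.Formula {F : Type*} [Field F] {e px py : ℕ} (D : LatticeParams e px py)
    (γ : ℕ → ℕ → F) : Prop :=
  γ (D.k 0) D.cy ≠ 0 ∧ γ (D.k 0 + D.Δx) D.cy ≠ 0 ∧
  (∀ u v : ℕ, D.denom γ u v ≠ 0 ∧
    γ (D.k v + D.Δx * u) (D.cy + D.Δy * v) = (D.ry : F) / D.denom γ u v) ∧
  (∀ n m : ℕ, e ≤ n + m → ¬ D.Mem n m → γ n m = 0)

/-- The set of exponents `(n, m)` of monomials of the algebra with `f n m ≠ 0` is `S`. -/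
def SupportIs {F : Type*} [Field F] (e : ℕ) (f : ℕ → ℕ → F) (S : ℕ → ℕ → Prop) : Prop :=
  ∀ n m : ℕ, e ≤ n + m → (f n m ≠ 0 ↔ S n m)

/-- `f n m = 0` for all exponents of monomials of the algebra. -/
def VanishesOn {F : Type*} [Field F] (e : ℕ) (f : ℕ → ℕ → F) : Prop :=
  ∀ n m : ℕ, e ≤ n + m → f n m = 0

/-!
Put `p = (p_x, p_y)`. The averaging identity forces the nonzero coefficients of `T` to be equal, so
that `R = γ · T` is a Rota-Baxter operator of weight zero iff
`γ_u γ_v = (γ_u + γ_v) γ_{u + v + p}` for all exponents `u`, `v` of monomials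
(`isRotaBaxter_iff_rotaBaxterRel`).

Read through `1 / γ`, this says that the shifted exponents `u + p` with `γ_u ≠ 0` are closed under
addition, that they are closed under differences as far as these are shifted exponents, and that
`u + p ↦ 1 / γ_u` is additive. If `γ` does not vanish, this means that there is a subgroup
`Γ` of `ℤ × ℤ × F` with `(u + p, z) ∈ Γ` iff `γ_u ≠ 0` and `z = 1 / γ_u`: the graph of an additive
function on a subgroup of `ℤ × ℤ` (`IsReciprocalGraph.rotaBaxterRel`,
`RotaBaxterRel.exists_isReciprocalGraph`).

The subgroup has a Hermite normal form with generators over `(Δ, 0)` and `(A, c)`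
(`exists_hermite_form`). If it has rank one, the support of `γ` is a ray (`exists_rayParams`).
Otherwise each row of the support is the part of a residue class modulo `Δ` from its first element
`k_v` on, and the sequences `σ` record how far `u + v + p` is from the first element of its row
when `u` and `v` are first elements (`exists_flatParams`, `exists_latticeParams`). Given the
support, the formula for `γ` expresses the additivity of `1 / γ` in terms of two known values.
Conversely, given the formula, the two values define a suitable `Γ`. For `p_y > 0` it has to be seen
that the given exponents form part of a lattice; this follows from the congruence `H(v) ≡ v C`
modulo `r_y`, which is built into the definition of `H` (`exists_hSeq_eq`,
`LatticeParams.exists_generator`).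
-/

/-! ### Reciprocal graphs -/

/-- The relation `γ_u γ_v = (γ_u + γ_v) γ_{u + v + p}` between coefficients, for all exponents
`u`, `v` of monomials and `p = (p_x, p_y)`. It says that `x ^ u ↦ γ_u x ^ (u + p)` is a
Rota-Baxter operator of weight zero. -/
def RotaBaxterRel {F : Type*} [Field F] (e px py : ℕ) (γ : ℕ → ℕ → F) : Prop :=
  ∀ n m n' m' : ℕ, e ≤ n + m → e ≤ n' + m' →
    γ n m * γ n' m' = (γ n m + γ n' m') * γ (n + n' + px) (m + m' + py)

/-- `Γ` meets the translate by `(p_x, p_y)` of the exponents of monomials in the graph of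
`u + p ↦ 1 / γ_u`, where `γ_u ≠ 0`. The equation `z * γ_u = 1` encodes both `γ_u ≠ 0` and
`z = 1 / γ_u`. -/
def IsReciprocalGraph {F : Type*} [Field F] (e px py : ℕ) (γ : ℕ → ℕ → F)
    (Γ : AddSubgroup (ℤ × ℤ × F)) : Prop :=
  ∀ (n m : ℕ) (z : F), e ≤ n + m → (((n : ℤ) + px, (m : ℤ) + py, z) ∈ Γ ↔ z * γ n m = 1)

section Graph

variable {F : Type*} [Field F] {e px py : ℕ} {γ : ℕ → ℕ → F} {Γ : AddSubgroup (ℤ × ℤ × F)}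

theorem IsReciprocalGraph.rotaBaxterRel (h : IsReciprocalGraph e px py γ Γ) :
    RotaBaxterRel e px py γ := by
  have key : ∀ n m n' m' : ℕ, e ≤ n + m → e ≤ n' + m' → γ n m ≠ 0 →
      γ n m * γ n' m' = (γ n m + γ n' m') * γ (n + n' + px) (m + m' + py) := by
    intro n m n' m' h1 h2 hu
    have hu' := (h n m (γ n m)⁻¹ h1).2 (inv_mul_cancel₀ hu)
    have h3 : e ≤ (n + n' + px) + (m + m' + py) := by omega
    by_cases hv : γ n' m' = 0
    · have hw : γ (n + n' + px) (m + m' + py) = 0 := by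
        by_contra hw
        have hw' := (h _ _ (γ (n + n' + px) (m + m' + py))⁻¹ h3).2 (inv_mul_cancel₀ hw)
        have hd := Γ.sub_mem hw' hu'
        have := (h n' m' ((γ (n + n' + px) (m + m' + py))⁻¹ - (γ n m)⁻¹) h2).1 (by
          convert hd using 1
          simp only [Prod.mk_sub_mk, Prod.mk.injEq]
          push_cast
          exact ⟨by ring, by ring, trivial⟩)
        rw [hv] at this
        simp at this
      rw [hv, hw]
      ring
    · have hv' := (h n' m' (γ n' m')⁻¹ h2).2 (inv_mul_cancel₀ hv)
      have := (h _ _ ((γ n m)⁻¹ + (γ n' m')⁻¹) h3).1 (by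
        convert Γ.add_mem hu' hv' using 1
        simp only [Prod.mk_add_mk, Prod.mk.injEq]
        push_cast
        exact ⟨by ring, by ring, trivial⟩)
      field_simp at this
      linear_combination -this
  intro n m n' m' h1 h2
  by_cases hu : γ n m = 0
  · by_cases hv : γ n' m' = 0
    · rw [hu, hv]
      ring
    · have := key n' m' n m h2 h1 hv
      rw [Nat.add_comm n' n, Nat.add_comm m' m] at this
      linear_combination this
  · exact key n m n' m' h1 h2 hu

/-- The exponents (shifted by `p`) with nonzero coefficient form a semigroup, which is closed under
those differences that are shifted exponents, and `1 / γ` is additive on it. The differences of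
the graph of `1 / γ` form the required group. -/
theorem RotaBaxterRel.exists_isReciprocalGraph (h : RotaBaxterRel e px py γ)
    (hne : ¬ VanishesOn e γ) : ∃ Γ, IsReciprocalGraph e px py γ Γ := by
  let S : Set (ℤ × ℤ × F) := {g | ∃ (n m : ℕ) (z : F), e ≤ n + m ∧ z * γ n m = 1 ∧
    g = ((n : ℤ) + px, (m : ℤ) + py, z)}
  have hS : ∀ s ∈ S, ∀ t ∈ S, s + t ∈ S := by
    rintro _ ⟨n, m, z, h1, hz, rfl⟩ _ ⟨n', m', z', h1', hz', rfl⟩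
    refine ⟨n + n' + px, m + m' + py, z + z', by omega, ?_, ?_⟩
    · linear_combination -z * z' * h n m n' m' h1 h1'
        + (z' * γ n' m' - z' * γ (n + n' + px) (m + m' + py)) * hz
        + (1 - z * γ (n + n' + px) (m + m' + py)) * hz'
    · simp only [Prod.mk_add_mk, Prod.mk.injEq]
      push_cast
      exact ⟨by ring, by ring, trivial⟩
  have hS0 : ∃ s, s ∈ S := by
    unfold VanishesOn at hne
    push Not at hne
    obtain ⟨n, m, h1, h2⟩ := hne
    exact ⟨_, n, m, (γ n m)⁻¹, h1, inv_mul_cancel₀ h2, rfl⟩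
  refine ⟨{ carrier := {g | ∃ s ∈ S, ∃ t ∈ S, g + t = s}
            add_mem' := ?_
            zero_mem' := ?_
            neg_mem' := ?_ }, ?_⟩
  · rintro g g' ⟨s, hs, t, ht, hg⟩ ⟨s', hs', t', ht', hg'⟩
    exact ⟨s + s', hS _ hs _ hs', t + t', hS _ ht _ ht', by rw [← hg, ← hg']; abel⟩
  · obtain ⟨s, hs⟩ := hS0
    exact ⟨s, hs, s, hs, by simp⟩
  · rintro g ⟨s, hs, t, ht, hg⟩
    exact ⟨t, ht, s, hs, by rw [← hg]; abel⟩
  · intro n m z h1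
    constructor
    · rintro ⟨_, ⟨n2, m2, z2, -, hz2, rfl⟩, _, ⟨n1, m1, z1, hm1, hz1, rfl⟩, hg⟩
      simp only [Prod.mk_add_mk, Prod.mk.injEq] at hg
      obtain ⟨hn, hm, rfl⟩ := hg
      obtain rfl : n2 = n + n1 + px := by omega
      obtain rfl : m2 = m + m1 + py := by omega
      linear_combination z1 * (z + z1) * h n m n1 m1 h1 hm1 - (γ n m * (z + z1) - 1) * hz1
        + (γ n m + γ n1 m1) * z1 * hz2
    · intro hz
      have hg : ((n : ℤ) + px, (m : ℤ) + py, z) ∈ S := ⟨n, m, z, h1, hz, rfl⟩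
      exact ⟨_, hS _ hg _ hg, _, hg, rfl⟩

theorem IsReciprocalGraph.mem_of_ne_zero (h : IsReciprocalGraph e px py γ Γ) {n m : ℕ}
    (h1 : e ≤ n + m) (h2 : γ n m ≠ 0) : ((n : ℤ) + px, (m : ℤ) + py, (γ n m)⁻¹) ∈ Γ :=
  (h n m _ h1).2 (inv_mul_cancel₀ h2)

theorem IsReciprocalGraph.ne_zero_iff (h : IsReciprocalGraph e px py γ Γ) {n m : ℕ}
    (h1 : e ≤ n + m) : γ n m ≠ 0 ↔ ∃ z, ((n : ℤ) + px, (m : ℤ) + py, z) ∈ Γ := by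
  refine ⟨fun h2 => ⟨_, h.mem_of_ne_zero h1 h2⟩, ?_⟩
  rintro ⟨z, hz⟩ h2
  have := (h n m z h1).1 hz
  simp [h2] at this

/-- A reciprocal graph is the graph of a function, unless it contains no point at all. -/
theorem IsReciprocalGraph.eq_zero_of_mem (h : IsReciprocalGraph e px py γ Γ) {n m : ℕ}
    (h1 : e ≤ n + m) (h2 : γ n m ≠ 0) {z : F} (hz : ((0 : ℤ), (0 : ℤ), z) ∈ Γ) : z = 0 := by
  have h3 := Γ.add_mem (h.mem_of_ne_zero h1 h2) hz
  simp only [Prod.mk_add_mk, add_zero] at h3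
  have h4 := (h n m _ h1).1 h3
  rw [add_mul, inv_mul_cancel₀ h2] at h4
  simpa [h2] using h4

theorem isReciprocalGraph_of_mem {P : ℕ → ℕ → Prop}
    (h0 : ∀ z, ((0 : ℤ), (0 : ℤ), z) ∈ Γ → z = 0)
    (h1 : ∀ n m, e ≤ n + m → ∀ z, ((n : ℤ) + px, (m : ℤ) + py, z) ∈ Γ → P n m)
    (h2 : ∀ n m, P n m → ∃ z, ((n : ℤ) + px, (m : ℤ) + py, z) ∈ Γ ∧ z * γ n m = 1)
    (h3 : ∀ n m, e ≤ n + m → ¬ P n m → γ n m = 0) : IsReciprocalGraph e px py γ Γ := by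
  intro n m z hnm
  constructor
  · intro hz
    obtain ⟨z', hz', h4⟩ := h2 n m (h1 n m hnm z hz)
    have h5 := Γ.sub_mem hz hz'
    simp only [Prod.mk_sub_mk, sub_self] at h5
    rw [sub_eq_zero.1 (h0 _ h5), h4]
  · intro hz
    have hP : P n m := by
      by_contra hP
      simp [h3 n m hnm hP] at hz
    obtain ⟨z', hz', h4⟩ := h2 n m hP
    have hγ : γ n m ≠ 0 := right_ne_zero_of_mul_eq_one h4
    rwa [mul_right_cancel₀ hγ (hz.trans h4.symm)]

/-- The Hermite normal form of a subgroup of `ℤ × ℤ × F` that is the graph of a function on a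
subgroup of `ℤ × ℤ`. -/
theorem exists_hermite_form (h0 : ∀ z, ((0 : ℤ), (0 : ℤ), z) ∈ Γ → z = 0) :
    ∃ (Δ c : ℕ) (A : ℤ) (φ ψ : F),
      Γ = AddSubgroup.closure {((Δ : ℤ), (0 : ℤ), φ), (A, (c : ℤ), ψ)} ∧
        ∀ (x : ℤ) (z : F), (x, (0 : ℤ), z) ∈ Γ → (Δ : ℤ) ∣ x := by
  let π : ℤ × ℤ × F →+ ℤ := (AddMonoidHom.fst ℤ F).comp (AddMonoidHom.snd ℤ (ℤ × F))
  have cyc : ∀ H : AddSubgroup ℤ, ∃ d : ℕ, H = AddSubgroup.zmultiples (d : ℤ) := by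
    intro H
    obtain ⟨a, ha⟩ := Int.subgroup_cyclic H
    refine ⟨a.natAbs, ?_⟩
    rw [ha, ← AddSubgroup.zmultiples_eq_closure, Int.zmultiples_natAbs]
  obtain ⟨c, hc⟩ := cyc (Γ.map π)
  obtain ⟨Δ, hΔ⟩ := cyc ((Γ ⊓ π.ker).map (AddMonoidHom.fst ℤ (ℤ × F)))
  obtain ⟨⟨A, c', ψ⟩, hA, hAc⟩ : (c : ℤ) ∈ Γ.map π := hc ▸ AddSubgroup.mem_zmultiples _
  obtain rfl : c' = c := hAc
  obtain ⟨⟨D, y, φ⟩, ⟨hD, hy⟩, hDΔ⟩ :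
      (Δ : ℤ) ∈ (Γ ⊓ π.ker).map (AddMonoidHom.fst ℤ (ℤ × F)) :=
    hΔ ▸ AddSubgroup.mem_zmultiples _
  obtain rfl : D = Δ := hDΔ
  obtain rfl : y = 0 := hy
  refine ⟨Δ, c, A, φ, ψ, le_antisymm ?_ ?_, fun x z hx => ?_⟩
  · rintro ⟨x, y, z⟩ hg
    obtain ⟨j, hj⟩ : y ∈ AddSubgroup.zmultiples (c : ℤ) := hc ▸ ⟨_, hg, rfl⟩
    have hg1 := Γ.sub_mem hg (Γ.zsmul_mem hA j)
    simp only [smul_eq_mul] at hj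
    simp only [Prod.smul_mk, Prod.mk_sub_mk, smul_eq_mul, hj, sub_self] at hg1
    obtain ⟨i, hi⟩ : x - j * A ∈ AddSubgroup.zmultiples (Δ : ℤ) := hΔ ▸ ⟨_, ⟨hg1, rfl⟩, rfl⟩
    have hg2 := Γ.sub_mem hg1 (Γ.zsmul_mem hD i)
    simp only [smul_eq_mul] at hi
    simp only [Prod.smul_mk, Prod.mk_sub_mk, smul_eq_mul, hi, sub_self, mul_zero] at hg2
    refine AddSubgroup.mem_closure_pair.2 ⟨i, j, ?_⟩
    simp only [Prod.smul_mk, Prod.mk_add_mk, smul_eq_mul, Prod.mk.injEq]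
    refine ⟨by linear_combination hi, by linear_combination hj, ?_⟩
    linear_combination -h0 _ hg2
  · rw [AddSubgroup.closure_le]
    rintro g (rfl | rfl)
    exacts [hD, hA]
  · have : x ∈ AddSubgroup.zmultiples (Δ : ℤ) := hΔ ▸ ⟨_, ⟨hx, rfl⟩, rfl⟩
    exact Int.mem_zmultiples_iff.1 this

/-- A subgroup in Hermite normal form, in terms of coordinates. -/
theorem mem_closure_hermite {Δ A c x y : ℤ} {φ ψ z : F} :
    (x, y, z) ∈ AddSubgroup.closure {(Δ, (0 : ℤ), φ), (A, c, ψ)} ↔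
      ∃ i j : ℤ, x = i * Δ + j * A ∧ y = j * c ∧ z = i * φ + j * ψ := by
  rw [AddSubgroup.mem_closure_pair]
  simp only [Prod.smul_mk, Prod.mk_add_mk, smul_eq_mul, zsmul_eq_mul, Prod.mk.injEq, mul_zero,
    zero_add]
  exact ⟨fun ⟨i, j, h1, h2, h3⟩ => ⟨i, j, h1.symm, h2.symm, h3.symm⟩,
    fun ⟨i, j, h1, h2, h3⟩ => ⟨i, j, h1.symm, h2.symm, h3.symm⟩⟩

theorem eq_zero_of_mem_closure_hermite {Δ A c : ℤ} {φ ψ z : F} (hΔ : Δ ≠ 0) (hc : c ≠ 0)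
    (hz : ((0 : ℤ), (0 : ℤ), z) ∈ AddSubgroup.closure {(Δ, (0 : ℤ), φ), (A, c, ψ)}) : z = 0 := by
  obtain ⟨i, j, h1, h2, h3⟩ := mem_closure_hermite.1 hz
  obtain rfl : j = 0 := by simpa [hc] using h2.symm
  obtain rfl : i = 0 := by simpa [hΔ] using h1.symm
  simpa using h3

end Graph

/-! ### Rays of exponents -/

section Ray

variable {F : Type*} [Field F] {e px py : ℕ} {γ : ℕ → ℕ → F}

theorem RayParams.mem_le (D : RayParams e px py) (s : ℕ) :
    e ≤ (D.k + D.a * s) + (D.c + D.b * s) := by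
  have := D.start_mem
  omega

/-- A reciprocal graph of rank one comes from a ray. -/
theorem exists_rayParams (hpx : 0 < px) {g : ℤ × ℤ × F}
    (hΓ : IsReciprocalGraph e px py γ (AddSubgroup.zmultiples g)) (hne : ¬ VanishesOn e γ) :
    ∃ D : RayParams e px py, SupportIs e γ D.Mem := by
  -- after a change of sign, the generator has a positive first coordinate
  obtain ⟨a, b, φ, ha, hΓ⟩ : ∃ (a b : ℤ) (φ : F), 0 ≤ a ∧
      IsReciprocalGraph e px py γ (AddSubgroup.zmultiples (a, b, φ)) := by
    obtain ⟨a, b, φ⟩ := g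
    rcases le_total 0 a with h | h
    · exact ⟨a, b, φ, h, hΓ⟩
    · refine ⟨-a, -b, -φ, by omega, ?_⟩
      rw [← AddSubgroup.zmultiples_neg] at hΓ
      exact hΓ
  have key : ∀ n m : ℕ, e ≤ n + m → (γ n m ≠ 0 ↔ ∃ i : ℤ, i * a = n + px ∧ i * b = m + py) := by
    intro n m hnm
    rw [hΓ.ne_zero_iff hnm]
    constructor
    · rintro ⟨z, i, hi⟩
      simp only [Prod.smul_mk, smul_eq_mul, zsmul_eq_mul, Prod.mk.injEq] at hi
      exact ⟨i, hi.1, hi.2.1⟩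
    · rintro ⟨i, h1, h2⟩
      exact ⟨i * φ, i, by simp [h1, h2]⟩
  have pos : ∀ (i : ℤ) (n : ℕ), i * a = n + px → 0 < i := by
    intro i n h
    by_contra! hi
    have : i * a ≤ 0 := mul_nonpos_of_nonpos_of_nonneg hi ha
    omega
  have hex : ∃ r : ℕ, 0 < r ∧ ∃ n m : ℕ, e ≤ n + m ∧
      (r : ℤ) * a = n + px ∧ (r : ℤ) * b = m + py := by
    unfold VanishesOn at hne
    push Not at hne
    obtain ⟨n, m, h1, h2⟩ := hne
    obtain ⟨i, h3, h4⟩ := (key n m h1).1 h2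
    lift i to ℕ using (pos i n h3).le
    exact ⟨i, by exact_mod_cast pos i n h3, n, m, h1, h3, h4⟩
  classical
  -- the ray starts at the least positive multiple of the generator that is a shifted exponent
  obtain ⟨hr, k, c, hkc, h1, h2⟩ := Nat.find_spec hex
  have hmin : ∀ i : ℕ, 0 < i → (∃ n m : ℕ, e ≤ n + m ∧ (i : ℤ) * a = n + px ∧
      (i : ℤ) * b = m + py) → Nat.find hex ≤ i := fun i h3 h4 => Nat.find_min' hex ⟨h3, h4⟩
  generalize Nat.find hex = r at hr h1 h2 hmin
  have hb : 0 ≤ b := by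
    by_contra! hb
    have : (r : ℤ) * b < 0 := mul_neg_of_pos_of_neg (by exact_mod_cast hr) hb
    omega
  lift a to ℕ using ha
  lift b to ℕ using hb
  refine ⟨⟨k, c, r, a, b, hr, by exact_mod_cast h1, by exact_mod_cast h2, hkc, ?_⟩, ?_⟩
  · rintro ⟨h3, h4, h5⟩
    have e1 : ((r - 1 : ℕ) : ℤ) = r - 1 := by push_cast [hr]; rfl
    have h6 : ((r - 1 : ℕ) : ℤ) * a = (k - a : ℕ) + px := by
      push_cast [h3, e1]
      linear_combination h1
    have := hmin (r - 1) (by exact_mod_cast pos _ _ h6) ⟨k - a, c - b, h5, h6, by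
      push_cast [h4, e1]
      linear_combination h2⟩
    omega
  · intro n m hnm
    rw [key n m hnm]
    constructor
    · rintro ⟨i, h3, h4⟩
      have hi := pos i n h3
      lift i to ℕ using hi.le
      obtain ⟨s, rfl⟩ := Nat.exists_eq_add_of_le (hmin i (by exact_mod_cast hi) ⟨n, m, hnm, h3, h4⟩)
      refine ⟨s, ?_, ?_⟩
      · zify
        push_cast at h3
        linear_combination h1 - h3
      · zify
        push_cast at h4
        linear_combination h2 - h4
    · rintro ⟨s, rfl, rfl⟩
      refine ⟨r + s, ?_, ?_⟩
      · push_cast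
        linear_combination h1
      · push_cast
        linear_combination h2

/-- A ray does not contain two points of one row and a point of another row. -/
theorem RayParams.row_eq (D : RayParams e px py) {x d y x' y' : ℕ} (hd : 0 < d)
    (h1 : D.Mem x y) (h2 : D.Mem (x + d) y) (h3 : D.Mem x' y') : y = y' := by
  obtain ⟨s, hs, hs'⟩ := h1
  obtain ⟨t, ht, ht'⟩ := h2
  obtain ⟨u, -, rfl⟩ := h3
  have hst : s ≠ t := by
    rintro rfl
    omega
  have : D.b * s = D.b * t := by omega
  rcases Nat.eq_zero_or_pos D.b with h | h
  · simp [h, hs']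
  · exact absurd (Nat.eq_of_mul_eq_mul_left h this) hst

variable [CharZero F]

theorem RayParams.rotaBaxterRel (hpx : 0 < px) (D : RayParams e px py) (h : D.Formula γ) :
    RotaBaxterRel e px py γ := by
  obtain ⟨h1, h2, h3⟩ := h
  have hr : (D.r : F) ≠ 0 := Nat.cast_ne_zero.2 D.r_pos.ne'
  have ha' := D.r_mul_a
  have hb' := D.r_mul_b
  have ha : 0 < D.a := Nat.pos_of_mul_pos_left (a := D.r) (by omega)
  zify at ha' hb'
  refine IsReciprocalGraph.rotaBaxterRel
    (Γ := AddSubgroup.zmultiples ((D.a : ℤ), (D.b : ℤ), ((D.r : F) * γ D.k D.c)⁻¹))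
    (isReciprocalGraph_of_mem (P := D.Mem) ?_ ?_ ?_ h3)
  · rintro z ⟨i, hi⟩
    simp only [Prod.smul_mk, smul_eq_mul, zsmul_eq_mul, Prod.mk.injEq] at hi
    obtain rfl : i = 0 := by simpa [ha.ne'] using hi.1
    simpa using hi.2.2.symm
  · rintro n m hnm z ⟨i, hi⟩
    simp only [Prod.smul_mk, smul_eq_mul, zsmul_eq_mul, Prod.mk.injEq] at hi
    obtain ⟨hn, hm, -⟩ := hi
    -- a point before the `r`-th one would make `start_first` fail
    have hir : (D.r : ℤ) ≤ i := by
      by_contra! hlt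
      obtain ⟨t, ht⟩ := Int.le.dest (show i ≤ D.r - 1 by omega)
      have e1 : (D.k : ℤ) - D.a = n + t * D.a := by linear_combination -ha' + hn - D.a * ht
      have e2 : (D.c : ℤ) - D.b = m + t * D.b := by linear_combination -hb' + hm - D.b * ht
      have e3 : (0 : ℤ) ≤ t * D.a := by positivity
      have e4 : (0 : ℤ) ≤ t * D.b := by positivity
      exact D.start_first (by omega)
    obtain ⟨s, hs⟩ := Int.le.dest hir
    refine ⟨s, ?_, ?_⟩
    · zify
      linear_combination -hn + ha' - D.a * hs
    · zify
      linear_combination -hm + hb' - D.b * hs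
  · rintro n m ⟨s, rfl, rfl⟩
    have hrs : (D.r : F) + s ≠ 0 := by
      have := D.r_pos
      exact_mod_cast (show D.r + s ≠ 0 by omega)
    refine ⟨((D.r : F) + s) * ((D.r : F) * γ D.k D.c)⁻¹, ⟨D.r + s, ?_⟩, ?_⟩
    · simp only [Prod.smul_mk, smul_eq_mul, zsmul_eq_mul, Prod.mk.injEq]
      push_cast
      refine ⟨by linear_combination ha', by linear_combination hb', rfl⟩
    · rw [h2]
      field_simp

theorem RayParams.formula_of_rotaBaxterRel (hR : RotaBaxterRel e px py γ)
    (D : RayParams e px py) (hS : SupportIs e γ D.Mem) : D.Formula γ := by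
  have h0 : ∀ s, γ (D.k + D.a * s) (D.c + D.b * s) ≠ 0 := fun s =>
    (hS _ _ (D.mem_le s)).2 ⟨s, rfl, rfl⟩
  have hk : γ D.k D.c ≠ 0 := by simpa using h0 0
  obtain ⟨Γ, hΓ⟩ := hR.exists_isReciprocalGraph fun h => hk (h _ _ D.start_mem)
  have hr : (D.r : F) ≠ 0 := Nat.cast_ne_zero.2 D.r_pos.ne'
  refine ⟨hk, fun s => ?_, fun n m hnm hM => ?_⟩
  · have hrs : (D.r : F) + s ≠ 0 := by
      have := D.r_pos
      exact_mod_cast (show D.r + s ≠ 0 by omega)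
    have g0 := hΓ.mem_of_ne_zero D.start_mem hk
    have g1 := hΓ.mem_of_ne_zero (D.mem_le s) (h0 s)
    have ha := D.r_mul_a
    have hb := D.r_mul_b
    zify at ha hb
    have hz := hΓ.eq_zero_of_mem D.start_mem hk
      (z := (D.r : F) * (γ (D.k + D.a * s) (D.c + D.b * s))⁻¹ - (D.r + s) * (γ D.k D.c)⁻¹) (by
        convert Γ.sub_mem (Γ.zsmul_mem g1 D.r) (Γ.zsmul_mem g0 (D.r + s)) using 1
        simp only [Prod.smul_mk, Prod.mk_sub_mk, smul_eq_mul, zsmul_eq_mul, Prod.mk.injEq]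
        push_cast
        exact ⟨by linear_combination -s * ha, by linear_combination -s * hb, rfl⟩)
    have := h0 s
    field_simp at hz ⊢
    linear_combination -hz
  · by_contra h
    exact hM ((hS n m hnm).1 h)

end Ray

/-! ### Residue classes in a row -/

theorem exists_first_in_residue_class (ν : ℕ) {Δ : ℕ} (hΔ : 0 < Δ) (B : ℤ) :
    ∃ k : ℕ, ν ≤ k ∧ k - ν < Δ ∧ (Δ : ℤ) ∣ k - B := by
  have h1 : (0 : ℤ) < Δ := by exact_mod_cast hΔ
  have h2 := Int.emod_nonneg (B - ν) h1.ne'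
  have h3 := Int.emod_lt_of_pos (B - ν) h1
  have h4 := Int.mul_ediv_add_emod (B - ν) Δ
  lift (B - ν) % Δ to ℕ using h2 with d
  refine ⟨ν + d, by omega, by omega, -((B - ν) / Δ), ?_⟩
  push_cast
  linear_combination h4

theorem exists_eq_add_mul_of_dvd {ν Δ k n : ℕ} (hk : k - ν < Δ) (hn : ν ≤ n)
    (hd : (Δ : ℤ) ∣ n - k) : ∃ u : ℕ, n = k + Δ * u := by
  obtain ⟨u, hu⟩ := hd
  have h0 : 0 ≤ u := by
    by_contra! h
    have : (Δ : ℤ) * u ≤ Δ * (-1) := by gcongr; omega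
    omega
  lift u to ℕ using h0
  exact ⟨u, by zify; linear_combination hu⟩

theorem nuFun_eq_zero {e n : ℕ} (hn : 0 < n) : nuFun e n = 0 := by simp [nuFun, hn.ne']

theorem le_add_of_nuFun_le {e n m : ℕ} (he : e ≤ 1) (h : nuFun e m ≤ n) : e ≤ n + m := by
  unfold nuFun at h
  split_ifs at h <;> omega

theorem nuFun_le_of_le_add {e n m : ℕ} (h : e ≤ n + m) : nuFun e m ≤ n := by
  unfold nuFun
  split_ifs <;> omega

/-! ### Lattices of exponents for `p_y = 0` -/

section Flat

variable {F : Type*} [Field F] {e px : ℕ} {γ : ℕ → ℕ → F}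

theorem nuFun_mul (e : ℕ) {c : ℕ} (hc : 0 < c) (v : ℕ) : nuFun e (c * v) = nuFun e v := by
  simp [nuFun, hc.ne']

theorem FlatParams.mem_le (he : e ≤ 1) (D : FlatParams e px) (u v : ℕ) :
    e ≤ (D.k v + D.Δ * u) + D.c * v := by
  refine le_add_of_nuFun_le he ?_
  rw [nuFun_mul e D.c_pos]
  exact (D.le_k v).trans (Nat.le_add_right _ _)

/-- The first point of the `v`-th row in terms of the generators `(Δ, 0)`, `(k_1 + p_x, c)`. -/
theorem FlatParams.row_eq (D : FlatParams e px) (v : ℕ) :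
    (D.k v : ℤ) + px = v * (D.k 1 + px) + D.Δ * (D.r - ∑ s ∈ Finset.range v, (D.σ s : ℤ)) := by
  rcases Nat.eq_zero_or_pos v with rfl | hv
  · have := D.Δ_mul_r
    zify at this
    simp [this]
  · have h1 : Finset.Icc 1 (v - 1) = Finset.Ico 1 v := by
      ext
      simp
      omega
    have h2 := D.k_eq v hv
    rw [h1] at h2
    rw [Finset.sum_range_eq_add_Ico _ hv, D.σ_zero]
    linear_combination h2

theorem FlatParams.mem_iff (D : FlatParams e px) {n m : ℕ} (hnm : e ≤ n + m) :
    D.Mem n m ↔ ∃ j : ℤ, (m : ℤ) = j * D.c ∧ (D.Δ : ℤ) ∣ n + px - j * (D.k 1 + px) := by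
  constructor
  · rintro ⟨u, v, rfl, rfl⟩
    refine ⟨v, by push_cast; ring, D.r - ∑ s ∈ Finset.range v, (D.σ s : ℤ) + u, ?_⟩
    push_cast
    linear_combination D.row_eq v
  · rintro ⟨j, hj, hd⟩
    have hc : (0 : ℤ) < D.c := by exact_mod_cast D.c_pos
    have hj0 : 0 ≤ j := by
      by_contra! h
      have := mul_neg_of_neg_of_pos h hc
      omega
    lift j to ℕ using hj0 with v
    obtain rfl : m = D.c * v := by zify; linear_combination hj
    obtain ⟨u, hu⟩ := exists_eq_add_mul_of_dvd (n := n) (D.k_lt v)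
      (by rw [← nuFun_mul e D.c_pos]; exact nuFun_le_of_le_add hnm) (by
        obtain ⟨w, hw⟩ := hd
        exact ⟨w - (D.r - ∑ s ∈ Finset.range v, (D.σ s : ℤ)), by
          linear_combination hw - D.row_eq v⟩)
    exact ⟨u, v, hu, rfl⟩

theorem FlatParams.r_pos (hpx : 0 < px) (D : FlatParams e px) : 0 < D.r := by
  have := D.Δ_mul_r
  exact Nat.pos_of_mul_pos_left (a := D.Δ) (by omega)

variable [CharZero F]

theorem FlatParams.rotaBaxterRel (hpx : 0 < px) (D : FlatParams e px) (h : D.Formula γ) :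
    RotaBaxterRel e px 0 γ := by
  obtain ⟨h0, h1, h2, h3⟩ := h
  have hr : (D.r : F) ≠ 0 := Nat.cast_ne_zero.2 (D.r_pos hpx).ne'
  have hΔ := D.Δ_pos
  have hc := D.c_pos
  refine IsReciprocalGraph.rotaBaxterRel
    (Γ := AddSubgroup.closure {((D.Δ : ℤ), (0 : ℤ), ((D.r : F) * γ (D.k 0) 0)⁻¹),
      ((D.k 1 : ℤ) + px, (D.c : ℤ), (γ (D.k 1) D.c)⁻¹)})
    (isReciprocalGraph_of_mem (P := D.Mem)
      (fun z => eq_zero_of_mem_closure_hermite (by omega) (by omega)) ?_ ?_ h3)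
  · intro n m hnm z hz
    obtain ⟨i, j, hi, hj, -⟩ := mem_closure_hermite.1 hz
    exact (D.mem_iff hnm).2 ⟨j, by linear_combination hj, i, by linear_combination hi⟩
  · rintro n m ⟨u, v, rfl, rfl⟩
    obtain ⟨hd, hγ⟩ := h2 u v
    refine ⟨_, mem_closure_hermite.2
      ⟨D.r - ∑ s ∈ Finset.range v, (D.σ s : ℤ) + u, v, ?_, ?_, rfl⟩, ?_⟩
    · push_cast
      linear_combination D.row_eq v
    · push_cast
      ring
    · rw [hγ]
      field_simp
      unfold FlatParams.denom
      push_cast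
      ring

theorem FlatParams.formula_of_rotaBaxterRel (he : e ≤ 1) (hpx : 0 < px)
    (hR : RotaBaxterRel e px 0 γ) (D : FlatParams e px) (hS : SupportIs e γ D.Mem) :
    D.Formula γ := by
  have hne : ∀ u v, γ (D.k v + D.Δ * u) (D.c * v) ≠ 0 := fun u v =>
    (hS _ _ (D.mem_le he u v)).2 ⟨u, v, rfl, rfl⟩
  have h0 : γ (D.k 0) 0 ≠ 0 := by simpa using hne 0 0
  have h1 : γ (D.k 1) D.c ≠ 0 := by simpa using hne 0 1
  have e0 : e ≤ D.k 0 + 0 := by simpa using D.mem_le he 0 0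
  have e1 : e ≤ D.k 1 + D.c := by simpa using D.mem_le he 0 1
  have hr : (D.r : F) ≠ 0 := Nat.cast_ne_zero.2 (D.r_pos hpx).ne'
  obtain ⟨Γ, hΓ⟩ := hR.exists_isReciprocalGraph fun h => h0 (h _ _ e0)
  refine ⟨h0, h1, fun u v => ?_, fun n m hnm hM => ?_⟩
  · have huv := hne u v
    have hz := hΓ.eq_zero_of_mem e0 h0
      (z := (D.r : F) * (γ (D.k v + D.Δ * u) (D.c * v))⁻¹ - D.r * v * (γ (D.k 1) D.c)⁻¹ -
        ((u : F) + D.r - ∑ s ∈ Finset.range v, (D.σ s : F)) * (γ (D.k 0) 0)⁻¹) (by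
        convert Γ.sub_mem (Γ.sub_mem
          (Γ.zsmul_mem (hΓ.mem_of_ne_zero (D.mem_le he u v) huv) D.r)
          (Γ.zsmul_mem (hΓ.mem_of_ne_zero e1 h1) (D.r * v)))
          (Γ.zsmul_mem (hΓ.mem_of_ne_zero e0 h0)
            ((u : ℤ) + D.r - ∑ s ∈ Finset.range v, (D.σ s : ℤ))) using 1
        simp only [Prod.smul_mk, Prod.mk_sub_mk, smul_eq_mul, zsmul_eq_mul, Prod.mk.injEq]
        push_cast
        have hk := D.Δ_mul_r
        zify at hk
        exact ⟨by linear_combination -D.r * D.row_eq v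
          - (u + D.r - ∑ s ∈ Finset.range v, (D.σ s : ℤ)) * hk, by ring, rfl⟩)
    have hd : γ (D.k v + D.Δ * u) (D.c * v) * D.denom γ u v =
        (D.r : F) * γ (D.k 0) 0 * γ (D.k 1) D.c := by
      unfold FlatParams.denom
      field_simp at hz
      linear_combination -hz
    have hd0 : D.denom γ u v ≠ 0 := by
      intro h
      rw [h, mul_zero] at hd
      exact mul_ne_zero (mul_ne_zero hr h0) h1 hd.symm
    exact ⟨hd0, by rw [eq_div_iff hd0, hd]⟩
  · by_contra h
    exact hM ((hS n m hnm).1 h)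

end Flat

theorem exists_flatParams (e px : ℕ) {Δ c : ℕ} (hΔ : 0 < Δ) (hc : 0 < c) (A : ℤ) :
    ∃ D : FlatParams e px, ∀ n m : ℕ, e ≤ n + m →
      (D.Mem n m ↔ ∃ j : ℤ, (m : ℤ) = j * c ∧ (Δ : ℤ) ∣ n + px - j * A) := by
  choose k hk1 hk2 hk3 using fun v : ℕ =>
    exists_first_in_residue_class (nuFun e v) hΔ (v * A - px)
  -- for `v = 0` this is `k 0 + px = Δ * u`, so that `σ 0` serves as `r`
  have hex : ∀ v : ℕ, ∃ u : ℕ, k v + k 1 + px = k (v + 1) + Δ * u := by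
    intro v
    refine exists_eq_add_mul_of_dvd (hk2 (v + 1)) (by simp [nuFun_eq_zero]) ?_
    obtain ⟨x, hx⟩ := hk3 v
    obtain ⟨y, hy⟩ := hk3 1
    obtain ⟨z, hz⟩ := hk3 (v + 1)
    refine ⟨x + y - z, ?_⟩
    push_cast at hx hy hz ⊢
    linear_combination hx + hy - hz
  choose σ hσ using hex
  refine ⟨⟨c, Δ, σ 0, k, σ, hc, hΔ, hk1, hk2, by have := hσ 0; simp only [zero_add] at this; omega,
    rfl, ?_⟩, ?_⟩
  · intro n hn
    induction n, hn using Nat.le_induction with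
    | base => simp
    | succ n hn ih =>
      have h1 : ∀ n, Finset.Icc 1 (n - 1) = Finset.Ico 1 n := by
        intro n
        ext
        simp
        omega
      rw [h1] at ih ⊢
      rw [Finset.sum_Ico_succ_top hn]
      have := hσ n
      zify at this
      push_cast
      linear_combination ih - this
  · intro n m hnm
    rw [FlatParams.mem_iff _ hnm]
    obtain ⟨w, hw⟩ := hk3 1
    push_cast at hw
    refine exists_congr fun j => and_congr_right fun _ => ?_
    have : (n : ℤ) + px - j * (k 1 + px) = n + px - j * A - Δ * (j * w) := by
      linear_combination -j * hw
    rw [this]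
    exact (dvd_sub_left (dvd_mul_right _ _))

/-! ### Lattices of exponents for `p_y > 0` -/

theorem hSeqAux_eq (r : ℕ) (σ₀ σ₁ : ℕ → ℕ) (i j : ℕ) :
    hSeqAux r σ₀ σ₁ i j =
      tauSeq r σ₀ σ₁ j + ∑ s ∈ Finset.range i, (r : ℤ) * σ₀ (s * r + j) := by
  unfold hSeqAux tauSeq
  simp only [Finset.mul_sum]
  ring

/-- `H(v)` is congruent modulo `r` to a linear function of `v`. This is what makes the exponents
given by `LatticeParams` a lattice. -/
theorem exists_hSeq_eq (r : ℕ) (σ₀ σ₁ : ℕ → ℕ) :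
    ∃ C : ℤ, ∀ v, (r : ℤ) ∣ hSeq r σ₀ σ₁ v - v * C := by
  refine ⟨σ₀ 0 + ∑ s ∈ Finset.Ico 1 r, ((σ₀ (s + 1) : ℤ) - σ₁ s), fun v => ?_⟩
  refine ⟨∑ s ∈ Finset.range (v / r), (σ₀ (s * r + v % r) : ℤ)
    - ∑ s ∈ Finset.Ico 1 (v % r), ((σ₀ (s + 1) : ℤ) - σ₁ s)
    - (v / r : ℕ) * (σ₀ 0 + ∑ s ∈ Finset.Ico 1 r, ((σ₀ (s + 1) : ℤ) - σ₁ s)), ?_⟩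
  have hv : ((r * (v / r) + v % r : ℕ) : ℤ) = v := by rw [Nat.div_add_mod]
  rw [Nat.cast_add, Nat.cast_mul] at hv
  unfold hSeq hSeqAux
  linear_combination (σ₀ 0 + ∑ s ∈ Finset.Ico 1 r, ((σ₀ (s + 1) : ℤ) - σ₁ s)) * hv

section Lattice

variable {F : Type*} [Field F] {e px py : ℕ} {γ : ℕ → ℕ → F}

theorem LatticeParams.Δy_pos (D : LatticeParams e px py) : 0 < D.Δy :=
  (Nat.zero_le _).trans_lt D.cy_lt

theorem LatticeParams.mem_le (he : e ≤ 1) (D : LatticeParams e px py) (u v : ℕ) :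
    e ≤ (D.k v + D.Δx * u) + (D.cy + D.Δy * v) :=
  le_add_of_nuFun_le he ((D.le_k v).trans (Nat.le_add_right _ _))

theorem LatticeParams.ry_mul_k (D : LatticeParams e px py) (v : ℕ) :
    (D.ry : ℤ) * (D.k v + px) =
      (D.ry + v) * (D.k 0 + px) - D.Δx * hSeq D.ry D.σ₀ D.σ₁ v := by
  have h := D.k_eq (v / D.ry) (v % D.ry) (Nat.mod_lt _ D.ry_pos)
  have hv' : v / D.ry * D.ry + v % D.ry = v := Nat.div_add_mod' _ _
  have hv : ((v / D.ry * D.ry + v % D.ry : ℕ) : ℤ) = v := by rw [hv']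
  rw [Nat.cast_add, Nat.cast_mul] at hv
  rw [hv', ← hSeqAux_eq] at h
  unfold hSeq
  linear_combination h + (D.k 0 + px : ℤ) * hv

/-- The exponents shifted by `p` lie in the lattice generated by `(Δ_x, 0)` and `(A, Δ_y)`. -/
theorem LatticeParams.exists_generator (D : LatticeParams e px py) :
    ∃ A C : ℤ, D.ry * A + D.Δx * C = D.k 0 + px ∧
      ∀ v : ℕ, (D.Δx : ℤ) ∣ D.k v + px - (D.ry + v) * A := by
  obtain ⟨C, hC⟩ := exists_hSeq_eq D.ry D.σ₀ D.σ₁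
  have hr : (D.ry : ℤ) ≠ 0 := by exact_mod_cast D.ry_pos.ne'
  have h1 := D.ry_mul_k 1
  obtain ⟨d, hd⟩ := hC 1
  -- `A` is the difference of the first points of the rows `1` and `0`, up to a multiple of `Δ_x`
  have hA : (D.ry : ℤ) * (D.k 1 - D.k 0 + D.Δx * d) + D.Δx * C = D.k 0 + px := by
    push_cast at h1 hd
    linear_combination h1 - D.Δx * hd
  refine ⟨_, C, hA, fun v => ?_⟩
  obtain ⟨w, hw⟩ := hC v
  refine ⟨C - w, mul_left_cancel₀ hr ?_⟩
  linear_combination D.ry_mul_k v - D.Δx * hw - (D.ry + v : ℤ) * hA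

theorem LatticeParams.mem_iff_of_generator (D : LatticeParams e px py) {A : ℤ}
    (hA : ∀ v : ℕ, (D.Δx : ℤ) ∣ D.k v + px - (D.ry + v) * A) {n m : ℕ} (hnm : e ≤ n + m) :
    D.Mem n m ↔ ∃ j : ℤ, (m : ℤ) + py = j * D.Δy ∧ (D.Δx : ℤ) ∣ n + px - j * A := by
  have hr := D.ry_mul
  zify at hr
  constructor
  · rintro ⟨u, v, rfl, rfl⟩
    obtain ⟨w, hw⟩ := hA v
    refine ⟨D.ry + v, ?_, w + u, ?_⟩
    · push_cast
      linear_combination -hr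
    · push_cast
      linear_combination hw
  · rintro ⟨j, hj, hd⟩
    have hΔ : (0 : ℤ) < D.Δy := by exact_mod_cast D.Δy_pos
    have hjr : (D.ry : ℤ) ≤ j := by
      by_contra! h
      have : (j - D.ry) * D.Δy ≤ (-1) * D.Δy := by gcongr; omega
      have := D.cy_lt
      have e1 : (j - D.ry) * (D.Δy : ℤ) = m - D.cy := by linear_combination -hj - hr
      omega
    obtain ⟨v, hv⟩ := Int.le.dest hjr
    obtain rfl : m = D.cy + D.Δy * v := by zify; linear_combination hj + hr - D.Δy * hv
    obtain ⟨u, hu⟩ := exists_eq_add_mul_of_dvd (n := n) (D.k_lt v) (nuFun_le_of_le_add hnm) (by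
        obtain ⟨w, hw⟩ := hd
        obtain ⟨w', hw'⟩ := hA v
        exact ⟨w - w', by linear_combination hw - hw' - A * hv⟩)
    exact ⟨u, v, hu, rfl⟩

variable [CharZero F]

theorem LatticeParams.rotaBaxterRel (D : LatticeParams e px py) (h : D.Formula γ) :
    RotaBaxterRel e px py γ := by
  obtain ⟨h0, h1, h2, h3⟩ := h
  have hr : (D.ry : F) ≠ 0 := Nat.cast_ne_zero.2 D.ry_pos.ne'
  have hΔx := D.Δx_pos
  have hΔy := D.Δy_pos
  have hry := D.ry_mul
  zify at hry
  obtain ⟨A, C, hAC, hA⟩ := D.exists_generator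
  -- `φ` and `ψ` are the values at `(Δ_x, 0)` and `(A, Δ_y)` of the additive extension of `1 / γ`
  set φ : F := (γ (D.k 0 + D.Δx) D.cy)⁻¹ - (γ (D.k 0) D.cy)⁻¹ with hφ
  set ψ : F := ((γ (D.k 0) D.cy)⁻¹ - C * φ) / D.ry with hψ
  refine IsReciprocalGraph.rotaBaxterRel
    (Γ := AddSubgroup.closure {((D.Δx : ℤ), (0 : ℤ), φ), (A, (D.Δy : ℤ), ψ)})
    (isReciprocalGraph_of_mem (P := D.Mem)
      (fun z => eq_zero_of_mem_closure_hermite (by omega) (by omega)) ?_ ?_ h3)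
  · intro n m hnm z hz
    obtain ⟨i, j, hi, hj, -⟩ := mem_closure_hermite.1 hz
    exact (D.mem_iff_of_generator hA hnm).2 ⟨j, hj, i, by linear_combination hi⟩
  · rintro n m ⟨u, v, rfl, rfl⟩
    obtain ⟨hd, hγ⟩ := h2 u v
    obtain ⟨w, hw⟩ := hA v
    refine ⟨_, mem_closure_hermite.2 ⟨w + u, D.ry + v, ?_, ?_, rfl⟩, ?_⟩
    · push_cast
      linear_combination hw
    · push_cast
      linear_combination -hry
    · have hΔ0 : (D.Δx : ℤ) ≠ 0 := by omega
      have hw' : (D.ry : ℤ) * w = (D.ry + v) * C - hSeq D.ry D.σ₀ D.σ₁ v := by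
        refine mul_left_cancel₀ hΔ0 ?_
        linear_combination D.ry_mul_k v - D.ry * hw - (D.ry + v : ℤ) * hAC
      have hwF := congrArg (Int.cast : ℤ → F) hw'
      push_cast at hwF
      have hψ' : (D.ry : F) * ψ = (γ (D.k 0) D.cy)⁻¹ - C * φ := by
        rw [hψ]
        field_simp
      have key : (D.ry : F) * (((w + u : ℤ) : F) * φ + ((D.ry + v : ℤ) : F) * ψ) =
          D.denom γ u v := by
        unfold LatticeParams.denom
        rw [div_eq_mul_inv, div_eq_mul_inv]
        push_cast
        rw [hφ] at hψ' ⊢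
        linear_combination ((γ (D.k 0 + D.Δx) D.cy)⁻¹ - (γ (D.k 0) D.cy)⁻¹) * hwF
          + ((D.ry : F) + v) * hψ'
      rw [hγ, mul_div_assoc', div_eq_one_iff_eq hd, mul_comm]
      exact key

theorem LatticeParams.formula_of_rotaBaxterRel (he : e ≤ 1)
    (hR : RotaBaxterRel e px py γ) (D : LatticeParams e px py) (hS : SupportIs e γ D.Mem) :
    D.Formula γ := by
  have hne : ∀ u v, γ (D.k v + D.Δx * u) (D.cy + D.Δy * v) ≠ 0 := fun u v =>
    (hS _ _ (D.mem_le he u v)).2 ⟨u, v, rfl, rfl⟩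
  have h0 : γ (D.k 0) D.cy ≠ 0 := by simpa using hne 0 0
  have h1 : γ (D.k 0 + D.Δx) D.cy ≠ 0 := by simpa using hne 1 0
  have e0 : e ≤ D.k 0 + D.cy := by simpa using D.mem_le he 0 0
  have e1 : e ≤ D.k 0 + D.Δx + D.cy := by simpa using D.mem_le he 1 0
  have hr : (D.ry : F) ≠ 0 := Nat.cast_ne_zero.2 D.ry_pos.ne'
  have hry := D.ry_mul
  zify at hry
  obtain ⟨Γ, hΓ⟩ := hR.exists_isReciprocalGraph fun h => h0 (h _ _ e0)
  refine ⟨h0, h1, fun u v => ?_, fun n m hnm hM => ?_⟩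
  · have huv := hne u v
    have g0 := hΓ.mem_of_ne_zero e0 h0
    have hz := hΓ.eq_zero_of_mem e0 h0
      (z := (D.ry : F) * (γ (D.k v + D.Δx * u) (D.cy + D.Δy * v))⁻¹
        - ((D.ry : F) + v) * (γ (D.k 0) D.cy)⁻¹
        - ((D.ry : F) * u - hSeq D.ry D.σ₀ D.σ₁ v) *
          ((γ (D.k 0 + D.Δx) D.cy)⁻¹ - (γ (D.k 0) D.cy)⁻¹)) (by
        convert Γ.sub_mem (Γ.sub_mem
          (Γ.zsmul_mem (hΓ.mem_of_ne_zero (D.mem_le he u v) huv) D.ry)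
          (Γ.zsmul_mem g0 (D.ry + v)))
          (Γ.zsmul_mem (Γ.sub_mem (hΓ.mem_of_ne_zero e1 h1) g0)
            (D.ry * u - hSeq D.ry D.σ₀ D.σ₁ v)) using 1
        simp only [Prod.smul_mk, Prod.mk_sub_mk, smul_eq_mul, zsmul_eq_mul, Prod.mk.injEq]
        push_cast
        exact ⟨by linear_combination -D.ry_mul_k v, by linear_combination -v * hry, rfl⟩)
    have hd : D.denom γ u v = D.ry * (γ (D.k v + D.Δx * u) (D.cy + D.Δy * v))⁻¹ := by
      unfold LatticeParams.denom
      rw [div_eq_mul_inv, div_eq_mul_inv]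
      linear_combination -hz
    have hd0 : D.denom γ u v ≠ 0 := by
      rw [hd]
      exact mul_ne_zero hr (inv_ne_zero huv)
    refine ⟨hd0, ?_⟩
    rw [hd]
    field_simp
  · by_contra h
    exact hM ((hS n m hnm).1 h)

end Lattice

theorem exists_latticeParams (e px : ℕ) {py Δ c : ℕ} (hpy : 0 < py) (hΔ : 0 < Δ) (hc : 0 < c)
    (A : ℤ) : ∃ D : LatticeParams e px py, ∀ n m : ℕ, e ≤ n + m →
      (D.Mem n m ↔ ∃ j : ℤ, (m : ℤ) + py = j * c ∧ (Δ : ℤ) ∣ n + px - j * A) := by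
  obtain ⟨cy, -, hcy, r, hr⟩ := exists_first_in_residue_class 0 hc (-py)
  have hr0 : 0 < r := by
    by_contra! h
    have := mul_nonpos_of_nonneg_of_nonpos (Int.natCast_nonneg c) h
    omega
  lift r to ℕ using hr0.le
  have hr1 : 0 < r := by exact_mod_cast hr0
  choose k hk1 hk2 hk3 using fun v : ℕ =>
    exists_first_in_residue_class (nuFun e (cy + c * v)) hΔ ((r + v) * A - px)
  -- `i = 0` gives the first and `i = 1` the second of the two sequences of `LatticeParams`
  have hex : ∀ v i : ℕ, ∃ u : ℕ, k v + k i + px = k (v + r + i) + Δ * u := by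
    intro v i
    have h0 : 0 < cy + c * (v + r + i) := by positivity
    refine exists_eq_add_mul_of_dvd (hk2 (v + r + i)) (by simp [nuFun_eq_zero h0]) ?_
    obtain ⟨x, hx⟩ := hk3 v
    obtain ⟨y, hy⟩ := hk3 i
    obtain ⟨z, hz⟩ := hk3 (v + r + i)
    refine ⟨x + y - z, ?_⟩
    push_cast at hx hy hz ⊢
    linear_combination hx + hy - hz
  choose σ hσ using hex
  have hstep : ∀ v, (Δ : ℤ) * σ v 0 = k v + k 0 + px - k (v + r) := by
    intro v
    have := hσ v 0
    zify at this
    rw [Nat.add_zero] at this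
    linear_combination -this
  -- the differences of the two sequences are second differences of `k`, and telescope
  have htel : ∀ b, 1 ≤ b → (Δ : ℤ) * ∑ s ∈ Finset.Ico 1 b, ((σ (s + 1) 0 : ℤ) - σ s 1) =
      k b - k 0 - b * (k 1 - k 0) := by
    intro b hb
    induction b, hb using Nat.le_induction with
    | base => simp
    | succ b hb ih =>
      rw [Finset.sum_Ico_succ_top hb]
      have h1 := hstep (b + 1)
      have h2 := hσ b 1
      zify at h2
      rw [show b + 1 + r = b + r + 1 by omega] at h1
      push_cast
      linear_combination ih + h1 + h2
  have htau : ∀ j, (Δ : ℤ) * tauSeq r (fun v => σ v 0) (fun v => σ v 1) j =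
      (r + j) * (k 0 + px) - r * (k j + px) := by
    intro j
    have h1 := hstep 0
    have h2 := htel r hr1
    rw [Nat.zero_add] at h1
    unfold tauSeq
    simp only [← Finset.mul_sum]
    rcases Nat.eq_zero_or_pos j with rfl | hj
    · simp
    · linear_combination j * h1 + j * h2 - r * htel j hj
  let D : LatticeParams e px py := ⟨cy, r, Δ, c, k, fun v => σ v 0, fun v => σ v 1, hr1, hΔ,
    by omega, by zify; linear_combination -hr, hk1, hk2, by
      intro i j hj
      induction i with
      | zero =>
        have := htau j
        simp only [Nat.zero_mul, Nat.zero_add, Finset.range_zero, Finset.sum_empty]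
        push_cast
        linear_combination this
      | succ i ih =>
        rw [Finset.sum_range_succ]
        have := hstep (i * r + j)
        rw [show i * r + j + r = (i + 1) * r + j by ring] at this
        push_cast
        linear_combination ih + r * this⟩
  refine ⟨D, fun n m hnm => D.mem_iff_of_generator (fun v => ?_) hnm⟩
  have := hk3 v
  rwa [show (k v : ℤ) - ((r + v) * A - px) = k v + px - (r + v) * A by ring] at this

/-! ### Classification of the coefficients -/

section Classification

variable {F : Type*} [Field F] {e px py : ℕ} {γ : ℕ → ℕ → F}

theorem RotaBaxterRel.exists_params (hpx : 0 < px) (h : RotaBaxterRel e px py γ)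
    (hne : ¬ VanishesOn e γ) :
    (∃ D : RayParams e px py, SupportIs e γ D.Mem) ∨
      (py = 0 ∧ ∃ D : FlatParams e px, SupportIs e γ D.Mem) ∨
      (0 < py ∧ ∃ D : LatticeParams e px py, SupportIs e γ D.Mem) := by
  obtain ⟨Γ, hΓ⟩ := h.exists_isReciprocalGraph hne
  have h0 : ∀ z, ((0 : ℤ), (0 : ℤ), z) ∈ Γ → z = 0 := by
    intro z hz
    by_contra hz0
    exact hne fun n m hnm => by_contra fun hγ => hz0 (hΓ.eq_zero_of_mem hnm hγ hz)
  obtain ⟨Δ, c, A, φ, ψ, rfl, hdvd⟩ := exists_hermite_form h0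
  have hφ : ((Δ : ℤ), (0 : ℤ), φ) ∈
    AddSubgroup.closure {((Δ : ℤ), (0 : ℤ), φ), (A, (c : ℤ), ψ)} :=
    AddSubgroup.subset_closure (by simp)
  have hψ : (A, (c : ℤ), ψ) ∈ AddSubgroup.closure {((Δ : ℤ), (0 : ℤ), φ), (A, (c : ℤ), ψ)} :=
    AddSubgroup.subset_closure (by simp)
  rcases Nat.eq_zero_or_pos Δ with rfl | hΔ
  · left
    obtain rfl : φ = 0 := h0 φ hφ
    refine exists_rayParams hpx (g := (A, (c : ℤ), ψ)) ?_ hne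
    convert hΓ using 1
    rw [AddSubgroup.zmultiples_eq_closure]
    exact (AddSubgroup.closure_insert_zero _).symm
  rcases Nat.eq_zero_or_pos c with rfl | hc
  · left
    refine exists_rayParams hpx (g := ((Δ : ℤ), (0 : ℤ), φ)) ?_ hne
    convert hΓ using 1
    obtain ⟨w, rfl⟩ := hdvd A ψ hψ
    have h1 : ψ - w • φ = 0 := h0 _ (by
      convert AddSubgroup.sub_mem _ hψ (AddSubgroup.zsmul_mem _ hφ w) using 1
      simp [mul_comm])
    refine le_antisymm ?_ ?_
    · rw [AddSubgroup.zmultiples_le]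
      exact hφ
    · rw [AddSubgroup.closure_le]
      rintro g (rfl | rfl)
      · exact AddSubgroup.mem_zmultiples _
      · refine ⟨w, ?_⟩
        simpa [mul_comm] using (sub_eq_zero.1 h1).symm
  have key : ∀ n m : ℕ, e ≤ n + m → (γ n m ≠ 0 ↔
      ∃ j : ℤ, (m : ℤ) + py = j * c ∧ (Δ : ℤ) ∣ n + px - j * A) := by
    intro n m hnm
    rw [hΓ.ne_zero_iff hnm]
    constructor
    · rintro ⟨z, hz⟩
      obtain ⟨i, j, hi, hj, -⟩ := mem_closure_hermite.1 hz
      exact ⟨j, hj, i, by linear_combination hi⟩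
    · rintro ⟨j, hj, i, hi⟩
      exact ⟨_, mem_closure_hermite.2 ⟨i, j, by linear_combination hi, hj, rfl⟩⟩
  right
  rcases Nat.eq_zero_or_pos py with rfl | hpy
  · obtain ⟨D, hD⟩ := exists_flatParams e px hΔ hc A
    refine Or.inl ⟨rfl, D, fun n m hnm => ?_⟩
    rw [key n m hnm, hD n m hnm]
    simp
  · obtain ⟨D, hD⟩ := exists_latticeParams e px hpy hΔ hc A
    refine Or.inr ⟨hpy, D, fun n m hnm => ?_⟩
    rw [key n m hnm, hD n m hnm]

theorem VanishesOn.rotaBaxterRel (h : VanishesOn e γ) : RotaBaxterRel e px py γ := by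
  intro n m n' m' h1 h2
  rw [h n m h1, h n' m' h2]
  ring

variable [CharZero F]

theorem rotaBaxterRel_iff (he : e ≤ 1) (hpx : 0 < px) :
    RotaBaxterRel e px py γ ↔
      VanishesOn e γ ∨ (∃ D : RayParams e px py, D.Formula γ) ∨
      (py = 0 ∧ ∃ D : FlatParams e px, D.Formula γ) ∨
      (0 < py ∧ ∃ D : LatticeParams e px py, D.Formula γ) := by
  constructor
  · intro h
    by_cases hne : VanishesOn e γ
    · exact Or.inl hne
    · refine Or.inr ?_
      rcases h.exists_params hpx hne with ⟨D, hD⟩ | ⟨rfl, D, hD⟩ | ⟨hpy, D, hD⟩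
      · exact Or.inl ⟨D, D.formula_of_rotaBaxterRel h hD⟩
      · exact Or.inr (Or.inl ⟨rfl, D, D.formula_of_rotaBaxterRel he hpx h hD⟩)
      · exact Or.inr (Or.inr ⟨hpy, D, D.formula_of_rotaBaxterRel he h hD⟩)
  · rintro (h | ⟨D, hD⟩ | ⟨rfl, D, hD⟩ | ⟨-, D, hD⟩)
    exacts [h.rotaBaxterRel, D.rotaBaxterRel hpx hD, D.rotaBaxterRel hpx hD, D.rotaBaxterRel hD]

/-- If all exponents with nonzero coefficient are on one ray, the supports of rank two in the
classification are excluded. -/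
theorem rotaBaxterRel_iff_of_mem_ray (he : e ≤ 1) (hpx : 0 < px) (D : RayParams e px py)
    (hD : ∀ n m, e ≤ n + m → γ n m ≠ 0 → D.Mem n m) :
    RotaBaxterRel e px py γ ↔
      VanishesOn e γ ∨ ∃ D' : RayParams e px py, D'.Formula γ := by
  constructor
  · intro h
    by_cases hne : VanishesOn e γ
    · exact Or.inl hne
    · refine Or.inr ?_
      rcases h.exists_params hpx hne with ⟨D', hD'⟩ | ⟨rfl, D', hD'⟩ | ⟨hpy, D', hD'⟩
      · exact ⟨D', D'.formula_of_rotaBaxterRel h hD'⟩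
      · exfalso
        have hM : ∀ u v, D.Mem (D'.k v + D'.Δ * u) (D'.c * v) := fun u v =>
          hD _ _ (D'.mem_le he u v) ((hD' _ _ (D'.mem_le he u v)).2 ⟨u, v, rfl, rfl⟩)
        have := D.row_eq (d := D'.Δ) D'.Δ_pos (by simpa using hM 0 0) (by simpa using hM 1 0)
          (hM 0 1)
        have := D'.c_pos
        omega
      · exfalso
        have hM : ∀ u v, D.Mem (D'.k v + D'.Δx * u) (D'.cy + D'.Δy * v) := fun u v =>
          hD _ _ (D'.mem_le he u v) ((hD' _ _ (D'.mem_le he u v)).2 ⟨u, v, rfl, rfl⟩)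
        have := D.row_eq (d := D'.Δx) D'.Δx_pos (by simpa using hM 0 0) (by simpa using hM 1 0)
          (hM 0 1)
        have := D'.Δy_pos
        omega
  · rintro (h | ⟨D', hD'⟩)
    exacts [h.rotaBaxterRel, D'.rotaBaxterRel hpx hD']

end Classification

/-! ### From operators to coefficients -/

section Operators

variable {F A : Type*} [Field F] [NonUnitalNonAssocRing A] [Module F A] [IsScalarTower F A A]
  [SMulCommClass F A A]

/-- The Rota-Baxter identity is bilinear, so that it can be checked on a spanning set. -/
theorem isRotaBaxter_of_span {s : Set A} (hs : Submodule.span F s = ⊤) {w : F} {R : A →ₗ[F] A}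
    (h : ∀ a ∈ s, ∀ b ∈ s, R a * R b = R (R a * b + a * R b + w • (a * b))) :
    IsRotaBaxter w R := by
  let B₁ : A →ₗ[F] A →ₗ[F] A := (LinearMap.mul F A).compl₁₂ R R
  let B₂ : A →ₗ[F] A →ₗ[F] A := ((LinearMap.mul F A).compl₁₂ R LinearMap.id +
    (LinearMap.mul F A).compl₁₂ LinearMap.id R + w • LinearMap.mul F A).compr₂ R
  have hB : B₁ = B₂ := LinearMap.ext_on hs fun a ha => LinearMap.ext_on hs fun b hb => h a ha b hb
  exact fun a b => LinearMap.congr_fun (LinearMap.congr_fun hB a) b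

variable {e px py : ℕ} {α γ : ℕ → ℕ → F} {x : ∀ n m : ℕ, e ≤ n + m → A} {T R : A →ₗ[F] A}

/-- Let `x n m` be the monomials of `A`. For `R = γ · T`, the Rota-Baxter
identity is an identity for `γ` alone: since `T` is averaging, its coefficients are equal where
they do not vanish, and if the coefficient at `u` does not vanish, then those at `v` and `u + v + p`
vanish or not simultaneously. -/
theorem isRotaBaxter_iff_rotaBaxterRel (hx : ∀ n m h, x n m h ≠ 0)
    (hspan : Submodule.span F {a | ∃ n m h, x n m h = a} = ⊤)
    (hmul : ∀ n m h n' m' h', x n m h * x n' m' h' = x (n + n') (m + m') (by omega))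
    (hTa : IsAveraging T)
    (hT : ∀ n m h, T (x n m h) = α n m • x (n + px) (m + py) (by omega))
    (hR : ∀ n m h, R (x n m h) = γ n m • T (x n m h))
    (hγ : ∀ n m, e ≤ n + m → α n m = 0 → γ n m = 0) :
    IsRotaBaxter (0 : F) R ↔ RotaBaxterRel e px py γ := by
  have hcongr : ∀ n m n' m' h h', n = n' → m = m' → x n m h = x n' m' h' := by
    rintro n m n' m' h h' rfl rfl
    rfl
  have hinj : ∀ n m h (c d : F), c • x n m h = d • x n m h → c = d := fun n m h c d hcd =>
    smul_left_injective F (hx n m h) hcd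
  have avg : ∀ n m n' m', e ≤ n + m → e ≤ n' + m' →
      α n m * α n' m' = α n m * α (n + n' + px) (m + m' + py) ∧
      α n m * α (n + n' + px) (m + m' + py) = α n' m' * α (n + n' + px) (m + m' + py) := by
    intro n m n' m' h h'
    obtain ⟨h1, h2⟩ := hTa (x n m h) (x n' m' h')
    have c1 := hcongr (n + px + n') (m + py + m') (n + n' + px) (m + m' + py) (by omega) (by omega)
      (by omega) (by omega)
    have c2 := hcongr (n + (n' + px)) (m + (m' + py)) (n + n' + px) (m + m' + py) (by omega)
      (by omega) (by omega) (by omega)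
    have c3 := hcongr (n + px + (n' + px)) (m + py + (m' + py)) (n + n' + px + px)
      (m + m' + py + py) (by omega) (by omega) (by omega) (by omega)
    simp only [hT, smul_mul_assoc, mul_smul_comm, hmul, map_smul, c1, c2, c3, smul_smul] at h1 h2
    exact ⟨by rw [mul_comm]; exact hinj _ _ _ _ _ h1, hinj _ _ _ _ _ h2⟩
  have hrel : ∀ n m n' m' (h : e ≤ n + m) (h' : e ≤ n' + m'),
      (R (x n m h) * R (x n' m' h') =
        R (R (x n m h) * x n' m' h' + x n m h * R (x n' m' h') +
          (0 : F) • (x n m h * x n' m' h')) ↔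
      γ n m * γ n' m' = (γ n m + γ n' m') * γ (n + n' + px) (m + m' + py)) := by
    intro n m n' m' h h'
    have c1 := hcongr (n + px + n') (m + py + m') (n + n' + px) (m + m' + py) (by omega) (by omega)
      (by omega) (by omega)
    have c2 := hcongr (n + (n' + px)) (m + (m' + py)) (n + n' + px) (m + m' + py) (by omega)
      (by omega) (by omega) (by omega)
    have c3 := hcongr (n + px + (n' + px)) (m + py + (m' + py)) (n + n' + px + px)
      (m + m' + py + py) (by omega) (by omega) (by omega) (by omega)
    simp only [hR, hT, smul_mul_assoc, mul_smul_comm, hmul, map_smul, c1, c2, c3,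
      smul_smul, zero_smul, add_zero, ← add_smul]
    rw [(smul_left_injective F (hx _ _ _)).eq_iff]
    have a1 := avg n m n' m' h h'
    have g0 := hγ n m h
    have g1 := hγ n' m' h'
    have g2 := hγ (n + n' + px) (m + m' + py) (by omega)
    generalize α (n + n' + px) (m + m' + py) = a₃ at *
    generalize γ (n + n' + px) (m + m' + py) = g₃ at *
    generalize α n m = a₁ at *
    generalize γ n m = g₁ at *
    generalize α n' m' = a₂ at *
    generalize γ n' m' = g₂ at *
    obtain ⟨a1, a2⟩ := a1
    by_cases h1 : a₁ = 0
    · rw [g0 h1]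
      by_cases h2 : a₂ = 0
      · rw [g1 h2]
        simp
      · have h3 : a₃ = 0 := by simpa [h1, h2] using a2.symm
        rw [g2 h3]
        simp
    · obtain rfl : a₂ = a₃ := mul_left_cancel₀ h1 a1
      by_cases h2 : a₂ = 0
      · rw [g1 h2, g2 h2]
        simp
      · obtain rfl : a₁ = a₂ := mul_right_cancel₀ h2 a2
        rw [← mul_right_inj' (mul_ne_zero h1 h1) (b := g₁ * g₂)]
        constructor <;> intro h3 <;> linear_combination h3
  constructor
  · intro h n m n' m' h1 h2
    exact (hrel n m n' m' h1 h2).1 (h _ _)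
  · intro h
    refine isRotaBaxter_of_span hspan ?_
    rintro _ ⟨n, m, h1, rfl⟩ _ ⟨n', m', h2, rfl⟩
    exact (hrel n m n' m' h1 h2).2 (h n m n' m' h1 h2)

end Operators

/-! ### The two polynomial algebras -/

section Polynomials

variable {F : Type*} [Field F]

theorem xyMonomial_mul (n m n' m' : ℕ) :
    xyMonomial F n m * xyMonomial F n' m' = xyMonomial F (n + n') (m + m') := by
  unfold xyMonomial
  ring

theorem xyMonomial_ne_zero (n m : ℕ) : xyMonomial F n m ≠ 0 :=
  mul_ne_zero (pow_ne_zero _ (MvPolynomial.X_ne_zero _)) (pow_ne_zero _ (MvPolynomial.X_ne_zero _))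

theorem smul_xyMonomial (c : F) (d : Fin 2 →₀ ℕ) :
    c • xyMonomial F (d 0) (d 1) = MvPolynomial.monomial d c := by
  rw [MvPolynomial.monomial_eq, MvPolynomial.smul_eq_C_mul, Finsupp.prod_fintype _ _ (by simp)]
  simp [xyMonomial]

theorem span_xyMonomial :
    Submodule.span F {a | ∃ (n m : ℕ) (_ : 0 ≤ n + m), xyMonomial F n m = a} = ⊤ := by
  refine eq_top_iff.2 fun p _ => ?_
  rw [p.as_sum]
  refine Submodule.sum_mem _ fun d _ => ?_
  rw [← smul_xyMonomial]
  exact Submodule.smul_mem _ _ (Submodule.subset_span ⟨d 0, d 1, Nat.zero_le _, rfl⟩)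

theorem one_le_of_mem_support {p : MvPolynomial (Fin 2) F} (hp : p ∈ PolyZero F)
    {d : Fin 2 →₀ ℕ} (hd : d ∈ p.support) : 1 ≤ d 0 + d 1 := by
  have h : p ∈ Ideal.span (MvPolynomial.X '' Set.univ : Set (MvPolynomial (Fin 2) F)) := by
    refine Ideal.span_mono ?_ hp
    rintro _ (rfl | rfl)
    exacts [⟨0, trivial, rfl⟩, ⟨1, trivial, rfl⟩]
  obtain ⟨i, -, hi⟩ := MvPolynomial.mem_ideal_span_X_image.1 h d hd
  fin_cases i <;> simp at hi <;> omega

theorem span_xyMonomialZero :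
    Submodule.span F {a | ∃ (n m : ℕ) (h : 1 ≤ n + m), xyMonomialZero F n m h = a} = ⊤ := by
  refine eq_top_iff.2 ?_
  rintro ⟨p, hp⟩ -
  have hsum : (⟨p, hp⟩ : PolyZero F) = ∑ d : p.support,
      p.coeff d • xyMonomialZero F (d.1 0) (d.1 1) (one_le_of_mem_support hp d.2) := by
    refine Subtype.ext ?_
    rw [AddSubmonoidClass.coe_finsetSum]
    change p = ∑ d : p.support, p.coeff d • xyMonomial F (d.1 0) (d.1 1)
    simp only [smul_xyMonomial]
    rw [Finset.sum_coe_sort p.support fun d => MvPolynomial.monomial d (p.coeff d)]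
    exact p.as_sum
  rw [hsum]
  exact Submodule.sum_mem _ fun d _ =>
    Submodule.smul_mem _ _ (Submodule.subset_span ⟨_, _, _, rfl⟩)

end Polynomials

/-- The classification for any algebra with a suitable spanning family of monomials. -/
theorem classification_of_monomials {F A : Type*} [Field F] [CharZero F] [NonUnitalNonAssocRing A]
    [Module F A] [IsScalarTower F A A] [SMulCommClass F A A] {e px py : ℕ} (he : e ≤ 1)
    (hpx : 0 < px) {α γ : ℕ → ℕ → F} {x : ∀ n m : ℕ, e ≤ n + m → A} {T R : A →ₗ[F] A}
    (hx : ∀ n m h, x n m h ≠ 0)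
    (hspan : Submodule.span F {a | ∃ n m h, x n m h = a} = ⊤)
    (hmul : ∀ n m h n' m' h', x n m h * x n' m' h' = x (n + n') (m + m') (by omega))
    (hTa : IsAveraging T)
    (hT : ∀ n m h, T (x n m h) = α n m • x (n + px) (m + py) (by omega))
    (hR : ∀ n m h, R (x n m h) = γ n m • T (x n m h))
    (hγ : ∀ n m, e ≤ n + m → α n m = 0 → γ n m = 0) :
    (IsRotaBaxter (0 : F) R ↔
      VanishesOn e γ ∨ (∃ D : RayParams e px py, D.Formula γ) ∨
      (py = 0 ∧ ∃ D : FlatParams e px, D.Formula γ) ∨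
      (0 < py ∧ ∃ D : LatticeParams e px py, D.Formula γ)) ∧
    (∀ D : RayParams e px py, SupportIs e α D.Mem →
      (IsRotaBaxter (0 : F) R ↔
        VanishesOn e γ ∨ ∃ D' : RayParams e px py, D'.Formula γ)) ∧
    (∀ D : RayParams e px py, SupportIs e γ D.Mem →
      (IsRotaBaxter (0 : F) R ↔ D.Formula γ)) ∧
    (py = 0 → ∀ D : FlatParams e px, SupportIs e γ D.Mem →
      (IsRotaBaxter (0 : F) R ↔ D.Formula γ)) ∧
    (0 < py → ∀ D : LatticeParams e px py, SupportIs e γ D.Mem →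
      (IsRotaBaxter (0 : F) R ↔ D.Formula γ)) := by
  rw [isRotaBaxter_iff_rotaBaxterRel hx hspan hmul hTa hT hR hγ]
  refine ⟨rotaBaxterRel_iff he hpx, fun D hD => ?_, fun D hD => ?_, ?_, fun _ D hD => ?_⟩
  · exact rotaBaxterRel_iff_of_mem_ray he hpx D fun n m hnm h =>
      (hD n m hnm).1 fun h0 => h (hγ n m hnm h0)
  · exact ⟨fun h => D.formula_of_rotaBaxterRel h hD, D.rotaBaxterRel hpx⟩
  · rintro rfl D hD
    exact ⟨fun h => D.formula_of_rotaBaxterRel he hpx h hD, D.rotaBaxterRel hpx⟩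
  · exact ⟨fun h => D.formula_of_rotaBaxterRel he h hD, D.rotaBaxterRel⟩

/-! ### The classification theorem -/

theorem mainTheorem5 {F : Type*} [Field F] [CharZero F] (px py : ℕ) (hpx : 0 < px)
    (α γ : ℕ → ℕ → F) :
    -- the algebra `F[x, y]`
    (∀ T R : MvPolynomial (Fin 2) F →ₗ[F] MvPolynomial (Fin 2) F,
      IsAveraging T →
      (∀ n m : ℕ, T (xyMonomial F n m) = α n m • xyMonomial F (n + px) (m + py)) →
      (∀ n m : ℕ, R (xyMonomial F n m) = γ n m • T (xyMonomial F n m)) →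
      (∀ n m : ℕ, α n m = 0 → γ n m = 0) →
      -- all Rota-Baxter operators of weight zero of the form `γ · T`
      (IsRotaBaxter (0 : F) R ↔
        VanishesOn 0 γ ∨ (∃ D : RayParams 0 px py, D.Formula γ) ∨
        (py = 0 ∧ ∃ D : FlatParams 0 px, D.Formula γ) ∨
        (0 < py ∧ ∃ D : LatticeParams 0 px py, D.Formula γ)) ∧
      -- if `T` is in case (a), then so is `R`
      (∀ D : RayParams 0 px py, SupportIs 0 α D.Mem →
        (IsRotaBaxter (0 : F) R ↔
          VanishesOn 0 γ ∨ ∃ D' : RayParams 0 px py, D'.Formula γ)) ∧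
      -- the formulas hold with any parameters that describe the monomials outside `ker R`
      (∀ D : RayParams 0 px py, SupportIs 0 γ D.Mem →
        (IsRotaBaxter (0 : F) R ↔ D.Formula γ)) ∧
      (py = 0 → ∀ D : FlatParams 0 px, SupportIs 0 γ D.Mem →
        (IsRotaBaxter (0 : F) R ↔ D.Formula γ)) ∧
      (0 < py → ∀ D : LatticeParams 0 px py, SupportIs 0 γ D.Mem →
        (IsRotaBaxter (0 : F) R ↔ D.Formula γ))) ∧
    -- the algebra `F₀[x, y]`
    (∀ T R : PolyZero F →ₗ[F] PolyZero F,
      IsAveraging T →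
      (∀ (n m : ℕ) (h : 1 ≤ n + m), T (xyMonomialZero F n m h) =
        α n m • xyMonomialZero F (n + px) (m + py) (by omega)) →
      (∀ (n m : ℕ) (h : 1 ≤ n + m), R (xyMonomialZero F n m h) =
        γ n m • T (xyMonomialZero F n m h)) →
      (∀ n m : ℕ, 1 ≤ n + m → α n m = 0 → γ n m = 0) →
      -- all Rota-Baxter operators of weight zero of the form `γ · T`
      (IsRotaBaxter (0 : F) R ↔
        VanishesOn 1 γ ∨ (∃ D : RayParams 1 px py, D.Formula γ) ∨
        (py = 0 ∧ ∃ D : FlatParams 1 px, D.Formula γ) ∨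
        (0 < py ∧ ∃ D : LatticeParams 1 px py, D.Formula γ)) ∧
      -- if `T` is in case (a), then so is `R`
      (∀ D : RayParams 1 px py, SupportIs 1 α D.Mem →
        (IsRotaBaxter (0 : F) R ↔
          VanishesOn 1 γ ∨ ∃ D' : RayParams 1 px py, D'.Formula γ)) ∧
      -- the formulas hold with any parameters that describe the monomials outside `ker R`
      (∀ D : RayParams 1 px py, SupportIs 1 γ D.Mem →
        (IsRotaBaxter (0 : F) R ↔ D.Formula γ)) ∧
      (py = 0 → ∀ D : FlatParams 1 px, SupportIs 1 γ D.Mem →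
        (IsRotaBaxter (0 : F) R ↔ D.Formula γ)) ∧
      (0 < py → ∀ D : LatticeParams 1 px py, SupportIs 1 γ D.Mem →
        (IsRotaBaxter (0 : F) R ↔ D.Formula γ))) := by
  exact ⟨fun T R hTa hT hR hγ =>
      classification_of_monomials (x := fun n m _ => xyMonomial F n m) (Nat.zero_le 1) hpx
        (fun n m _ => xyMonomial_ne_zero n m) span_xyMonomial
        (fun n m _ n' m' _ => xyMonomial_mul n m n' m') hTa (fun n m _ => hT n m)
        (fun n m _ => hR n m) (fun n m _ => hγ n m),
    fun T R hTa hT hR hγ =>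
      classification_of_monomials (x := xyMonomialZero F) le_rfl hpx
        (fun n m _ h => xyMonomial_ne_zero n m (congrArg Subtype.val h)) span_xyMonomialZero
        (fun n m _ n' m' _ => Subtype.ext (xyMonomial_mul n m n' m')) hTa hT hR hγ⟩
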